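/- Let $d\ge 1$ and $U:\mathbb R^d\to\mathbb R$, with $\|\cdot\|$ the Euclidean norm, operator norms on derivatives, and $B(0,r)$ the open ball. Consider the assumptions * **H1**: $U$ is $C^2$, $\nabla U(0)=0$, and $\sup_x\|D^2U(x)\|\le L$ for some $L\ge 0$; * **H2**: $U$ is $C^3$ and $\sup_x\|D^3U(x)\|\le M$ for some $M\ge 0$; * **H3**: there are $m>0$ and $K\ge 0$ with $D^2U(x)\{y\}^{\otimes 2}\ge m$ for all $x,y\in\mathbb R^d$ with $\|x\|\ge K$, $\|y\|=1$. Let $\pi\propto e^{-U}$ and, for $\gamma>0$, let $R_\gamma$ be the kernel of MALA, $$R_\gamma(x,A)=\int_A\alpha_\gamma(x,y)r_\gamma(x,y)\,dy+\delta_x(A)\int_{\mathbb R^d}\{1-\alpha_\gamma(x,y)\}r_\gamma(x,y)\,dy ,$$ $$r_\gamma(x,y)=(4\pi\gamma)^{-d/2}\exp\Big(-\frac{\|y-x+\gamma\nabla U(x)\|^2}{4\gamma}\Big),\qquad \alpha_\gamma(x,y)=1\wedge\frac{e^{-U(y)}r_\gamma(y,x)}{e^{-U(x)}r_\gamma(x,y)}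 .$$ Put $\bar\eta=m/16$, $V(x)=\exp(\bar\eta\|x\|^2)$, $\tilde K=2K(1+L/m)$, $K^{U}=\max(\tilde K,4\sqrt{d/m})$. Fix $\Upsilon\in(0,1]$ and set $$\Gamma_{1/2}=\min\Big(\Upsilon,\frac{m^3}{4L^4},\frac1d\Big),\qquad b_{1/2}=C_{2,\Gamma_{1/2}}\,d+\sup_{u\ge1}\{u e^{-u/2^7}\},$$ $$K^{M}=\max\Big(2^4,2K,K^{U},\tilde K,\frac{4\, b_{1/2}^{1/2}}{(m\bar\eta)^{1/2}}\Big),\qquad \varpi=\frac{\bar\eta m (K^{M})^2}{16},\qquad \Gamma=\min\Big(\Gamma_{1/2},\frac{m^3}{4L^4},\frac1d,\frac{4}{m\bar\eta (K^{M})^2}\Big),$$ where, for $\bar\gamma>0$, $$C_{2,\bar\gamma}=2L+\frac{2^{1/2}L^2}{\epsilon}+\frac{\bar\gamma}{2}L^2+\frac{2^{-3/2}\bar\gamma^{3/2}L^3}{\epsilon},\qquad \epsilon=\frac{m^3}{2^4}\big\{2^{1/2}L^2+2^{-3/2}\bar\gamma^{1/2}L^3\big\}^{-1}.$$ Let also $$a_{\bar\gamma}=\bar\eta\{m/4+(1+16\bar\eta\bar\gamma)(4\bar\eta+2L+\bar\gamma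 L^2)\}(K^U)^2+4\bar\eta d,\qquad b^{U}_{\bar\gamma}=a_{\bar\gamma}e^{\bar\gamma a_{\bar\gamma}},$$ $$C_{1,\bar\gamma}=2\big(2^{1/2}M\vee\bar\gamma^{1/2}ML\vee 2L^2[1\vee\bar\gamma^{1/2}\vee\bar\gamma L\vee(\bar\gamma L^{4/3})^{3/2}]\big),$$ $$b^{M}_{\bar\gamma}=b^{U}_{\bar\gamma}+\frac{\bar\eta m(K^{M})^2e^{\bar\eta (K^{M})^2}}{16}+C_{1,\bar\gamma}\bar\gamma^{1/2}\{d+\sqrt3 d^2+(K^{M})^2\}.$$ **Proposition.** Assume H1 and H3. Then $0<\Gamma\le\Gamma_{1/2}$, and for every $\bar\gamma\in(0,\Gamma]$ there is a constant $b$, depending only on $d,L,m,K,\Upsilon,\bar\gamma$, such that for all $\gamma\in(0,\bar\gamma]$ and all $x\in\mathbb R^d$ the function $V$ is $R_\gamma(x,\cdot)$-integrable and $$R_\gamma V(x)\le(1-\varpi\gamma)V(x)+b\,\gamma\,\mathbf 1_{B(0,K^{M})}(x).$$ If moreover H2 holds with constant $M$, this holds for every $\bar\gamma\in(0,\Gamma]$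 with the explicit constant $b=b^{M}_{\bar\gamma}$. -/

import Mathlib

open MeasureTheory

noncomputable section

namespace MALA

/-- The state space `ℝ^d` with its Euclidean norm. -/
abbrev E (d : ℕ) : Type := EuclideanSpace ℝ (Fin d)

/-- The second derivative of `U` at `x`, as a continuous bilinear form (with its operator norm). -/
def D2 {d : ℕ} (U : E d → ℝ) (x : E d) : E d →L[ℝ] E d →L[ℝ] ℝ :=
  fderiv ℝ (fderiv ℝ U) x

/-- The third derivative of `U` at `x`, as a continuous trilinear form (with its operator norm). -/
def D3 {d : ℕ} (U : E d → ℝ) (x : E d) : ContinuousMultilinearMap ℝ (fun _ : Fin 3 => E d) ℝ :=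
  iteratedFDeriv ℝ 3 U x

/-- Assumption H1: `U` is `C²`, `∇U(0) = 0` and `sup_x ‖D²U(x)‖ ≤ L`. -/
structure H1 {d : ℕ} (U : E d → ℝ) (L : ℝ) : Prop where
  contDiff : ContDiff ℝ 2 U
  grad_zero : gradient U 0 = 0
  nonneg : 0 ≤ L
  bound : ∀ x, ‖D2 U x‖ ≤ L

/-- Assumption H2: `U` is `C³` and `sup_x ‖D³U(x)‖ ≤ M`. -/
structure H2 {d : ℕ} (U : E d → ℝ) (M : ℝ) : Prop where
  contDiff : ContDiff ℝ 3 U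
  nonneg : 0 ≤ M
  bound : ∀ x, ‖D3 U x‖ ≤ M

/-- Assumption H3: `D²U(x){y}^{⊗2} ≥ m` whenever `‖x‖ ≥ K` and `‖y‖ = 1`. -/
structure H3 {d : ℕ} (U : E d → ℝ) (m K : ℝ) : Prop where
  m_pos : 0 < m
  K_nonneg : 0 ≤ K
  bound : ∀ x y : E d, K ≤ ‖x‖ → ‖y‖ = 1 → m ≤ D2 U x y y

/-! ### The MALA kernel -/

/-- The target density `π = exp(-U)` (a normalising constant would cancel in `accept`). -/
def target {d : ℕ} (U : E d → ℝ) (x : E d) : ℝ := Real.exp (-U x)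

/-- The Euler-Maruyama proposal density `r_γ(x, y)`. -/
def proposal {d : ℕ} (U : E d → ℝ) (γ : ℝ) (x y : E d) : ℝ :=
  (4 * Real.pi * γ) ^ (-(d : ℝ) / 2) *
    Real.exp (-(4 * γ)⁻¹ * ‖y - x + γ • gradient U x‖ ^ 2)

/-- The Metropolis acceptance ratio `α_γ(x, y)`. -/
def accept {d : ℕ} (U : E d → ℝ) (γ : ℝ) (x y : E d) : ℝ :=
  min 1 (target U y * proposal U γ y x / (target U x * proposal U γ x y))

/-- The MALA kernel `R_γ(x, ·)`: an accepted move has Lebesgue density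
`y ↦ α_γ(x, y) r_γ(x, y)`, and the rejected mass stays at `x`. -/
def kernel {d : ℕ} (U : E d → ℝ) (γ : ℝ) (x : E d) : Measure (E d) :=
  (volume : Measure (E d)).withDensity
      (fun y => ENNReal.ofReal (accept U γ x y * proposal U γ x y)) +
    (∫⁻ y : E d, ENNReal.ofReal ((1 - accept U γ x y) * proposal U γ x y)) • Measure.dirac x

/-- The Lyapunov function `V_η(x) = exp(η ‖x‖²)`. -/
def V {d : ℕ} (η : ℝ) (x : E d) : ℝ := Real.exp (η * ‖x‖ ^ 2)

/-- The drift inequality for `R_γ` at step size `γ`: for all `x`, `V_η` is `R_γ(x, ·)`-integrable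
and `R_γ V_η(x) ≤ (1 - ϖ γ) V_η(x) + b γ 1_{B(0, ρ)}(x)`, with `B(0, ρ)` the open ball. -/
def Drift {d : ℕ} (U : E d → ℝ) (γ η ϖ b ρ : ℝ) : Prop :=
  ∀ x : E d, Integrable (V η) (kernel U γ x) ∧
    ∫ y, V η y ∂(kernel U γ x) ≤
      (1 - ϖ * γ) * V η x + b * γ * (Metric.ball (0 : E d) ρ).indicator (fun _ => (1 : ℝ)) x

/-! ### The explicit constants -/

/-- `η̄ = m / 16`. -/
def eta (m : ℝ) : ℝ := m / 16

/-- `K̃ = 2 K (1 + L / m)`. -/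
def Ktilde (L m K : ℝ) : ℝ := 2 * K * (1 + L / m)

/-- `K^U = max(K̃, 4 √(d / m))`. -/
def KU (d : ℕ) (L m K : ℝ) : ℝ := max (Ktilde L m K) (4 * Real.sqrt (d / m))

/-- The factor `η̄ {m/4 + (1 + 16 η̄ γ̄)(4 η̄ + 2 L + γ̄ L²)} (K^U)² + 4 η̄ d` of `bU`. -/
def bUrate (d : ℕ) (L m K γbar : ℝ) : ℝ :=
  eta m * (m / 4 + (1 + 16 * eta m * γbar) * (4 * eta m + 2 * L + γbar * L ^ 2)) *
    KU d L m K ^ 2 + 4 * eta m * d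

/-- `b^U`. -/
def bU (d : ℕ) (L m K γbar : ℝ) : ℝ :=
  bUrate d L m K γbar * Real.exp (γbar * bUrate d L m K γbar)

/-- `C_{1,γ̄}`. -/
def C1 (L M γbar : ℝ) : ℝ :=
  2 * max (Real.sqrt 2 * M) (max (Real.sqrt γbar * M * L)
    (2 * L ^ 2 * max 1 (max (Real.sqrt γbar) (max (γbar * L)
      ((γbar * L ^ (4 / 3 : ℝ)) ^ (3 / 2 : ℝ))))))

/-- `ε = (m³ / 2⁴) {2^{1/2} L² + 2^{-3/2} γ̄^{1/2} L³}⁻¹`. -/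
def eps (L m γbar : ℝ) : ℝ :=
  (m ^ 3 / 2 ^ 4) *
    (Real.sqrt 2 * L ^ 2 + (2 : ℝ) ^ (-(3 / 2) : ℝ) * Real.sqrt γbar * L ^ 3)⁻¹

/-- `C_{2,γ̄}`. -/
def C2 (L m γbar : ℝ) : ℝ :=
  2 * L + Real.sqrt 2 * L ^ 2 * (eps L m γbar)⁻¹ + γbar / 2 * L ^ 2 +
    (2 : ℝ) ^ (-(3 / 2) : ℝ) * γbar ^ (3 / 2 : ℝ) * L ^ 3 * (eps L m γbar)⁻¹

/-- `Γ_{1/2} = min(Υ, m³ / (4 L⁴), 1 / d)`. -/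
def Ghalf (d : ℕ) (L m Υ : ℝ) : ℝ := min Υ (min (m ^ 3 / (4 * L ^ 4)) (d : ℝ)⁻¹)

/-- `b_{1/2} = C_{2,Γ_{1/2}} d + sup_{u ≥ 1} u e^{-u/2⁷}`. -/
def bhalf (d : ℕ) (L m Υ : ℝ) : ℝ :=
  C2 L m (Ghalf d L m Υ) * d +
    sSup ((fun u : ℝ => u * Real.exp (-u / 2 ^ 7)) '' Set.Ici 1)

/-- `K^M = max(2⁴, 2 K, K^U, K̃, 4 b_{1/2}^{1/2} / (m η̄)^{1/2})`. -/
def KM (d : ℕ) (L m K Υ : ℝ) : ℝ :=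
  max (2 ^ 4) (max (2 * K) (max (KU d L m K) (max (Ktilde L m K)
    (4 * Real.sqrt (bhalf d L m Υ) / Real.sqrt (m * eta m)))))

/-- `Γ = min(Γ_{1/2}, m³ / (4 L⁴), 1 / d, 4 / (m η̄ (K^M)²))`. -/
def G (d : ℕ) (L m K Υ : ℝ) : ℝ :=
  min (Ghalf d L m Υ) (min (m ^ 3 / (4 * L ^ 4)) (min (d : ℝ)⁻¹
    (4 / (m * eta m * KM d L m K Υ ^ 2))))

/-- `ϖ = η̄ m (K^M)² / 16`. -/
def varpi (d : ℕ) (L m K Υ : ℝ) : ℝ := eta m * m * KM d L m K Υ ^ 2 / 16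

/-- `b^M = b^U + η̄ m (K^M)² e^{η̄ (K^M)²} / 16 + C_{1,γ̄} γ̄^{1/2} {d + √3 d² + (K^M)²}`. -/
def bM (d : ℕ) (L M m K Υ γbar : ℝ) : ℝ :=
  bU d L m K γbar +
    eta m * m * KM d L m K Υ ^ 2 * Real.exp (eta m * KM d L m K Υ ^ 2) / 16 +
    C1 L M γbar * Real.sqrt γbar * (d + Real.sqrt 3 * d ^ 2 + KM d L m K Υ ^ 2)

end MALA

end

noncomputable section

namespace MALA

/-! A MALA step from `x` either accepts a proposal or stays, so `R_γ V(x)` is at most the Gaussian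
integral `Q_γ V(x)` of the proposal plus `V(x)` times the rejection probability (`H1.kernel_V_le`).
Completing the square evaluates `Q_γ V` in closed form. The rejection probability is bounded by a
quadratic in the noise `w = y - x + γ ∇U(x)`, whose second moment is at most `6γd`.

Write `R = K^M` and `P = m η̄ R²`, so that `ϖ = P/16`. Where `‖x‖² ≥ 7R²/8`, convexity at infinity
makes the drift contract and `Q_γ V ≤ (1 - γP/8) V`. Convexity also makes the main term of the
logarithmic Metropolis ratio favourable, so rejection costs only `O(γ d L²/m)`. The term `b_{1/2}`
in `K^M` forces this below `γP/16`, and half of the contraction survives (`drift_far`).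

Where `‖x‖² ≤ 7R²/8`, crude Lipschitz bounds suffice: `V(x)` is smaller than `exp(η̄R²)` by a factor
at least `exp(η̄R²/8)`, which absorbs every loss into `γ ϖ exp(η̄R²)` (`drift_near`). Hence `b = ϖ
exp(η̄R²)` already works, and it is one of the nonnegative summands of `b^M`. -/

/-! ### Calculus -/

/-- If `f'` is the derivative of `f`, `f''` that of `f'` and `f'' ≥ c` on `[0, 1]`, then
`f 1 - f 0 - f' 1 ≤ -c / 2`. -/
lemma sub_sub_deriv_le_of_le_deriv2 {f f' f'' : ℝ → ℝ} {c : ℝ}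
    (hf : ∀ t, HasDerivAt f (f' t) t) (hf' : ∀ t, HasDerivAt f' (f'' t) t)
    (h : ∀ t, 0 ≤ t → t ≤ 1 → c ≤ f'' t) : f 1 - f 0 - f' 1 ≤ -c / 2 := by
  have h1 : MonotoneOn (fun t => f' t - c * t) (Set.Icc 0 1) := by
    have hd : ∀ t, HasDerivAt (fun t => f' t - c * t) (f'' t - c * 1) t := fun t =>
      (hf' t).sub ((hasDerivAt_id t).const_mul c)
    refine monotoneOn_of_deriv_nonneg (convex_Icc 0 1)
      (fun t _ => (hd t).continuousAt.continuousWithinAt)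
      (fun t _ => (hd t).differentiableAt.differentiableWithinAt) fun t ht => ?_
    rw [interior_Icc] at ht
    rw [(hd t).deriv]
    linarith [h t ht.1.le ht.2.le]
  -- The derivative is `f' t - f' 1 + c (1 - t)`, nonpositive by the monotonicity in `h1`.
  have h2 : AntitoneOn (fun t => f t - t * f' 1 + c * (t - t ^ 2 / 2)) (Set.Icc 0 1) := by
    have hd : ∀ t, HasDerivAt (fun t => f t - t * f' 1 + c * (t - t ^ 2 / 2))
        (f' t - 1 * f' 1 + c * (1 - (2 : ℕ) * t ^ (2 - 1) * 1 / 2)) t := fun t =>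
      ((hf t).sub ((hasDerivAt_id t).mul_const (f' 1))).add
        (((hasDerivAt_id t).sub (((hasDerivAt_id t).pow 2).div_const 2)).const_mul c)
    refine antitoneOn_of_deriv_nonpos (convex_Icc 0 1)
      (fun t _ => (hd t).continuousAt.continuousWithinAt)
      (fun t _ => (hd t).differentiableAt.differentiableWithinAt) fun t ht => ?_
    rw [interior_Icc] at ht
    rw [(hd t).deriv]
    have := h1 ⟨ht.1.le, ht.2.le⟩ (Set.right_mem_Icc.2 zero_le_one) ht.2.le
    norm_num at this ⊢
    linarith
  have := h2 (Set.left_mem_Icc.2 zero_le_one) (Set.right_mem_Icc.2 zero_le_one) zero_le_one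
  norm_num at this
  linarith

lemma inner_gradient_eq {d : ℕ} (U : E d → ℝ) (x v : E d) :
    inner ℝ (gradient U x) v = fderiv ℝ U x v := by
  rw [← toDual_gradient, InnerProductSpace.toDual_apply_apply]

section

variable {d : ℕ} {U : E d → ℝ} {L m K : ℝ}

lemma H1.hasFDerivAt (h : H1 U L) (x : E d) : HasFDerivAt U (fderiv ℝ U x) x :=
  (h.contDiff.differentiable (by norm_num) x).hasFDerivAt

lemma H1.hasFDerivAt_fderiv (h : H1 U L) (x : E d) :
    HasFDerivAt (fderiv ℝ U) (D2 U x) x :=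
  ((h.contDiff.fderiv_right (m := 1) (by norm_num)).differentiable
    (by norm_num) x).hasFDerivAt

lemma H1.hasDerivAt_line (h : H1 U L) (x v : E d) (t : ℝ) :
    HasDerivAt (fun t : ℝ => U (x + t • v)) (fderiv ℝ U (x + t • v) v) t := by
  have hl : HasDerivAt (fun t : ℝ => x + t • v) v t := by
    simpa using ((hasDerivAt_id t).smul_const v).const_add x
  exact (h.hasFDerivAt (x + t • v)).comp_hasDerivAt t hl

lemma H1.hasDerivAt_fderiv_line (h : H1 U L) (x v : E d) (t : ℝ) :
    HasDerivAt (fun t : ℝ => fderiv ℝ U (x + t • v) v) (D2 U (x + t • v) v v) t := by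
  have hl : HasDerivAt (fun t : ℝ => x + t • v) v t := by
    simpa using ((hasDerivAt_id t).smul_const v).const_add x
  have := (h.hasFDerivAt_fderiv (x + t • v)).comp_hasDerivAt t hl
  simpa using this.clm_apply (hasDerivAt_const t v)

lemma H1.norm_gradient_sub_le (h : H1 U L) (x y : E d) :
    ‖gradient U y - gradient U x‖ ≤ L * ‖y - x‖ := by
  have := convex_univ.norm_image_sub_le_of_norm_fderiv_le (𝕜 := ℝ) (f := fderiv ℝ U)
    (fun x _ => (h.hasFDerivAt_fderiv x).differentiableAt) (fun x _ => h.bound x)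
    (Set.mem_univ x) (Set.mem_univ y)
  rwa [← toDual_gradient, ← toDual_gradient, ← map_sub, LinearIsometryEquiv.norm_map] at this

lemma H1.norm_gradient_le (h : H1 U L) (x : E d) : ‖gradient U x‖ ≤ L * ‖x‖ := by
  simpa [h.grad_zero] using h.norm_gradient_sub_le 0 x

lemma H1.continuous_gradient (h : H1 U L) : Continuous (gradient U) := by
  have : Continuous (fderiv ℝ U) :=
    continuous_iff_continuousAt.2 fun x => (h.hasFDerivAt_fderiv x).continuousAt
  exact (InnerProductSpace.toDual ℝ (E d)).symm.continuous.comp this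

lemma H1.abs_D2_le (h : H1 U L) (x v : E d) : |D2 U x v v| ≤ L * ‖v‖ ^ 2 := by
  calc |D2 U x v v| ≤ ‖D2 U x‖ * ‖v‖ * ‖v‖ := (D2 U x).le_opNorm₂ v v
    _ ≤ L * ‖v‖ * ‖v‖ := by gcongr; exact h.bound x
    _ = _ := by ring

lemma H3.le_D2 (h : H3 U m K) {x : E d} (hx : K ≤ ‖x‖) (v : E d) :
    m * ‖v‖ ^ 2 ≤ D2 U x v v := by
  rcases eq_or_ne v 0 with rfl | hv
  · simp
  have hv' : ‖v‖ ≠ 0 := norm_ne_zero_iff.2 hv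
  have := h.bound x (‖v‖⁻¹ • v) hx (by simp [norm_smul, hv'])
  simp only [map_smul, smul_apply, smul_eq_mul] at this
  calc m * ‖v‖ ^ 2 ≤ (‖v‖⁻¹ * (‖v‖⁻¹ * D2 U x v v)) * ‖v‖ ^ 2 := by gcongr
    _ = _ := by field_simp

/-- Both Hessian bounds are tested on one unit vector, which exists because `d ≥ 1`, at a point of
norm `K`. This yields `L > 0`, so the quotients by `L` in the step-size threshold are genuine. -/
lemma H3.le_of_H1 (hd : 1 ≤ d) (h1 : H1 U L) (h3 : H3 U m K) : m ≤ L := by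
  have : Nonempty (Fin d) := ⟨⟨0, hd⟩⟩
  obtain ⟨v, hv⟩ := exists_norm_eq (E d) zero_le_one
  obtain ⟨x, hx⟩ := exists_norm_eq (E d) h3.K_nonneg
  have a := h3.bound x v hx.ge hv
  have b := (le_abs_self _).trans (h1.abs_D2_le x v)
  rw [hv] at b
  linarith

/-- The quantity `U(y) - U(x) - ⟨∇U(y), y - x⟩` is controlled by a lower bound on the Hessian. -/
lemma H1.sub_sub_inner_le (h : H1 U L) (x y : E d) {c : ℝ}
    (hc : ∀ t : ℝ, 0 ≤ t → t ≤ 1 → c ≤ D2 U (x + t • (y - x)) (y - x) (y - x)) :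
    U y - U x - inner ℝ (gradient U y) (y - x) ≤ -c / 2 := by
  have := sub_sub_deriv_le_of_le_deriv2 (h.hasDerivAt_line x (y - x))
    (h.hasDerivAt_fderiv_line x (y - x)) hc
  simpa [inner_gradient_eq] using this

/-- The Hessian is integrated along the ray from the point of norm `K` to `x`, where it is at least
`m`. At that starting point the gradient has norm at most `L K`, since `∇U(0) = 0`. -/
lemma H3.le_inner_gradient (h1 : H1 U L) (h3 : H3 U m K) {x : E d} (hx : K ≤ ‖x‖) :
    m * ‖x‖ ^ 2 - K * (m + L) * ‖x‖ ≤ inner ℝ (gradient U x) x := by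
  rcases eq_or_ne x 0 with rfl | hx0
  · simp
  have hN : 0 < ‖x‖ := norm_pos_iff.2 hx0
  set t₀ : ℝ := K / ‖x‖ with ht₀
  have ht0 : 0 ≤ t₀ := div_nonneg h3.K_nonneg hN.le
  have ht1 : t₀ ≤ 1 := (div_le_one hN).2 hx
  have htN : t₀ * ‖x‖ = K := div_mul_cancel₀ _ hN.ne'
  have hd : ∀ t, HasDerivAt (fun t : ℝ => fderiv ℝ U (0 + t • x) x - m * ‖x‖ ^ 2 * t)
      (D2 U (0 + t • x) x x - m * ‖x‖ ^ 2 * 1) t := fun t =>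
    (h1.hasDerivAt_fderiv_line 0 x t).sub ((hasDerivAt_id t).const_mul _)
  have hmono : MonotoneOn (fun t : ℝ => fderiv ℝ U (0 + t • x) x - m * ‖x‖ ^ 2 * t)
      (Set.Icc t₀ 1) := by
    refine monotoneOn_of_deriv_nonneg (convex_Icc t₀ 1)
      (fun t _ => (hd t).continuousAt.continuousWithinAt)
      (fun t _ => (hd t).differentiableAt.differentiableWithinAt) fun t ht => ?_
    rw [interior_Icc] at ht
    rw [(hd t).deriv]
    have : K ≤ ‖(0 : E d) + t • x‖ := by
      rw [zero_add, norm_smul, Real.norm_of_nonneg (ht0.trans ht.1.le), ← htN]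
      exact mul_le_mul_of_nonneg_right ht.1.le hN.le
    linarith [h3.le_D2 this x]
  have key := hmono (Set.left_mem_Icc.2 ht1) (Set.right_mem_Icc.2 ht1) ht1
  simp only [zero_add, one_smul, ← inner_gradient_eq] at key
  have hlow : -(L * K * ‖x‖) ≤ inner ℝ (gradient U (t₀ • x)) x := by
    have a := abs_real_inner_le_norm (gradient U (t₀ • x)) x
    have b := h1.norm_gradient_le (t₀ • x)
    rw [norm_smul, Real.norm_of_nonneg ht0, htN] at b
    have c := mul_le_mul_of_nonneg_right b hN.le
    linarith [neg_abs_le (inner ℝ (gradient U (t₀ • x)) x)]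
  have : m * ‖x‖ ^ 2 * t₀ = m * K * ‖x‖ := by rw [← htN]; ring
  nlinarith

end

/-! ### Gaussian integrals of the proposal -/

section

variable {d : ℕ} {U : E d → ℝ} {γ : ℝ}

lemma integrable_exp_neg_mul_sq_norm {b : ℝ} (hb : 0 < b) :
    Integrable fun v : E d => Real.exp (-b * ‖v‖ ^ 2) := by
  refine Integrable.of_integral_ne_zero ?_
  rw [GaussianFourier.integral_rexp_neg_mul_sq_norm hb]
  positivity

/-- Completing the square: with `s = 4γη < 1`, the tilted Gaussian has its exponent scaled by `1 -
s` and its centre moved by `s/(1 - s)` times the offset from `p`. -/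
lemma proposal_mul_exp_eq (hγ : 0 < γ) {η : ℝ} (hη : 4 * γ * η < 1) (x p y : E d) :
    proposal U γ x y * Real.exp (η * ‖y - p‖ ^ 2) =
      (4 * Real.pi * γ) ^ (-(d : ℝ) / 2) *
        Real.exp (η / (1 - 4 * γ * η) * ‖x - γ • gradient U x - p‖ ^ 2) *
      Real.exp (-((1 - 4 * γ * η) / (4 * γ)) *
        ‖y - (x - γ • gradient U x +
          (4 * γ * η / (1 - 4 * γ * η)) • (x - γ • gradient U x - p))‖ ^ 2) := by
  have h1 : (1 - 4 * γ * η) ≠ 0 := by linarith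
  set v := x - γ • gradient U x - p with hv
  set u := y - x + γ • gradient U x with hu
  have e1 : y - p = u + v := by rw [hu, hv]; abel
  have e2 : y - (x - γ • gradient U x + (4 * γ * η / (1 - 4 * γ * η)) • v) =
      u - (4 * γ * η / (1 - 4 * γ * η)) • v := by rw [hu]; abel
  rw [proposal, e1, e2]
  generalize (4 * Real.pi * γ) ^ (-(d : ℝ) / 2) = c
  rw [mul_assoc, mul_assoc, ← Real.exp_add, ← Real.exp_add, ← hu]
  clear_value u v
  rw [norm_add_sq_real, norm_sub_sq_real, norm_smul, mul_pow, inner_smul_right, Real.norm_eq_abs,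
    sq_abs]
  congr 2
  generalize inner ℝ u v = i
  field_simp
  ring

lemma integrable_proposal_mul_exp (hγ : 0 < γ) {η : ℝ} (hη : 4 * γ * η < 1) (x p : E d) :
    Integrable fun y => proposal U γ x y * Real.exp (η * ‖y - p‖ ^ 2) := by
  simp_rw [proposal_mul_exp_eq hγ hη]
  refine Integrable.const_mul ?_ _
  exact (integrable_exp_neg_mul_sq_norm (div_pos (by linarith) (by linarith))).comp_sub_right _

lemma integral_proposal_mul_exp (hγ : 0 < γ) {η : ℝ} (hη : 4 * γ * η < 1) (x p : E d) :
    ∫ y, proposal U γ x y * Real.exp (η * ‖y - p‖ ^ 2) =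
      (1 - 4 * γ * η) ^ (-(d : ℝ) / 2) *
        Real.exp (η / (1 - 4 * γ * η) * ‖x - γ • gradient U x - p‖ ^ 2) := by
  have h1 : 0 < 1 - 4 * γ * η := by linarith
  simp_rw [proposal_mul_exp_eq hγ hη]
  rw [integral_const_mul, integral_sub_right_eq_self (fun z : E d =>
    Real.exp (-((1 - 4 * γ * η) / (4 * γ)) * ‖z‖ ^ 2)),
    GaussianFourier.integral_rexp_neg_mul_sq_norm (by positivity), finrank_euclideanSpace_fin,
    mul_right_comm]
  congr 1
  have e : Real.pi / ((1 - 4 * γ * η) / (4 * γ)) = 4 * Real.pi * γ / (1 - 4 * γ * η) := by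
    field_simp
  rw [e, Real.div_rpow (by positivity) h1.le, neg_div, Real.rpow_neg (by positivity),
    Real.rpow_neg h1.le]
  have : (4 * Real.pi * γ) ^ ((d : ℝ) / 2) ≠ 0 := by positivity
  field_simp

lemma proposal_pos (hγ : 0 < γ) (x y : E d) : 0 < proposal U γ x y := by
  unfold proposal; positivity

lemma integrable_proposal (hγ : 0 < γ) (x : E d) : Integrable (proposal U γ x) := by
  simpa using integrable_proposal_mul_exp (U := U) hγ (η := 0) (by simp) x 0

lemma integral_proposal (hγ : 0 < γ) (x : E d) : ∫ y, proposal U γ x y = 1 := by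
  simpa using integral_proposal_mul_exp (U := U) hγ (η := 0) (by simp) x 0

lemma one_sub_rpow_neg_le {s : ℝ} (hs : 0 ≤ s) (hs2 : s ≤ 1 / 2) :
    (1 - s) ^ (-(d : ℝ) / 2) ≤ Real.exp (d * s) := by
  have h1 : 0 < 1 - s := by linarith
  rw [Real.rpow_def_of_pos h1]
  refine Real.exp_le_exp.2 ?_
  have h2 : -(2 * s) ≤ Real.log (1 - s) := by
    have := Real.one_sub_inv_le_log_of_pos h1
    have h3 : (1 - s)⁻¹ ≤ 1 + 2 * s := by
      rw [inv_le_iff_one_le_mul₀ h1]; nlinarith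
    linarith
  nlinarith [Nat.cast_nonneg (α := ℝ) d]

/-- A second moment bound for the proposal, from its exponential moment at `(8 γ d)⁻¹`. -/
lemma sq_norm_le_exp (hγ : 0 < γ) (hd : 1 ≤ d) (w : E d) :
    ‖w‖ ^ 2 ≤ 8 * γ * d * (Real.exp ((8 * γ * d)⁻¹ * ‖w‖ ^ 2) - 1) := by
  have hd' : (0 : ℝ) < d := by exact_mod_cast hd
  have := Real.add_one_le_exp ((8 * γ * d)⁻¹ * ‖w‖ ^ 2)
  calc ‖w‖ ^ 2 = 8 * γ * d * ((8 * γ * d)⁻¹ * ‖w‖ ^ 2) := by field_simp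
    _ ≤ _ := by gcongr; linarith

/-- The exponent `(8γd)⁻¹` makes `s = 1/(2d)`, so `(1 - s)^(-d/2)` stays bounded uniformly in `d`
and the second moment bound is linear in `d`. -/
lemma four_mul_mul_inv_lt (hγ : 0 < γ) (hd : 1 ≤ d) :
    4 * γ * (8 * γ * d)⁻¹ = (2 * (d : ℝ))⁻¹ ∧ (2 * (d : ℝ))⁻¹ ≤ 1 / 2 := by
  have hd' : (1 : ℝ) ≤ d := by exact_mod_cast hd
  refine ⟨by field_simp; norm_num, ?_⟩
  rw [one_div]
  exact inv_anti₀ (by norm_num) (by linarith)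

lemma continuous_proposal (x : E d) : Continuous (proposal U γ x) := by
  unfold proposal; fun_prop

lemma integrable_proposal_mul_sq_norm (hγ : 0 < γ) (hd : 1 ≤ d) (x : E d) :
    Integrable fun y => proposal U γ x y * ‖y - x + γ • gradient U x‖ ^ 2 := by
  obtain ⟨h1, h2⟩ := four_mul_mul_inv_lt hγ hd
  have hi := ((integrable_proposal_mul_exp (U := U) hγ (η := (8 * γ * d)⁻¹)
    (by rw [h1]; linarith) x (x - γ • gradient U x)).const_mul (8 * γ * d))
  refine hi.mono' ?_ (.of_forall fun y => ?_)
  · exact ((continuous_proposal x).mul (by fun_prop)).aestronglyMeasurable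
  · have hp := (proposal_pos (U := U) hγ x y).le
    rw [Real.norm_of_nonneg (by positivity), ← sub_add]
    have := sq_norm_le_exp hγ hd (y - x + γ • gradient U x)
    have h8 : (0 : ℝ) ≤ 8 * γ * d := by positivity
    calc proposal U γ x y * ‖y - x + γ • gradient U x‖ ^ 2 ≤ proposal U γ x y *
        (8 * γ * d * Real.exp ((8 * γ * d)⁻¹ * ‖y - x + γ • gradient U x‖ ^ 2)) := by
          gcongr; linarith
      _ = _ := by ring

lemma integral_proposal_mul_sq_norm_le (hγ : 0 < γ) (hd : 1 ≤ d) (x : E d) :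
    ∫ y, proposal U γ x y * ‖y - x + γ • gradient U x‖ ^ 2 ≤ 6 * γ * d := by
  obtain ⟨h1, h2⟩ := four_mul_mul_inv_lt hγ hd
  have hd' : (0 : ℝ) < d := by exact_mod_cast hd
  have hlt : 4 * γ * (8 * γ * d)⁻¹ < 1 := by rw [h1]; linarith
  have hi := integrable_proposal_mul_exp (U := U) hγ hlt x (x - γ • gradient U x)
  have hp := integrable_proposal (U := U) hγ x
  calc ∫ y, proposal U γ x y * ‖y - x + γ • gradient U x‖ ^ 2
      ≤ ∫ y, 8 * γ * d * (proposal U γ x y *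
          Real.exp ((8 * γ * d)⁻¹ * ‖y - (x - γ • gradient U x)‖ ^ 2) - proposal U γ x y) := by
        refine integral_mono (integrable_proposal_mul_sq_norm hγ hd x)
          ((hi.sub hp).const_mul _) fun y => ?_
        have := mul_le_mul_of_nonneg_left (sq_norm_le_exp hγ hd (y - x + γ • gradient U x))
          (proposal_pos (U := U) hγ x y).le
        simp only [← sub_add]
        linarith
    _ = 8 * γ * d * ((1 - (2 * (d : ℝ))⁻¹) ^ (-(d : ℝ) / 2) - 1) := by
        rw [integral_const_mul, integral_sub hi hp, integral_proposal_mul_exp hγ hlt,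
          integral_proposal hγ, h1]
        simp
    -- Here `(1 - s)^(-d/2) ≤ exp(d s) = exp(1/2) ≤ 7/4`. The exact second moment is `2γd`; the
    -- constant `6` is enough.
    _ ≤ 8 * γ * d * (7 / 4 - 1) := by
        gcongr
        refine (one_sub_rpow_neg_le (by positivity) h2).trans ?_
        have e : (d : ℝ) * (2 * (d : ℝ))⁻¹ = 1 / 2 := by field_simp
        rw [e]
        have h := Real.exp_one_lt_d9
        have h' : Real.exp (1 / 2) ^ 2 = Real.exp 1 := by
          rw [← Real.exp_nat_mul]; norm_num
        nlinarith [Real.exp_pos (1 / 2)]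
    _ = _ := by ring

end

/-! ### The acceptance ratio -/

/-- The opposite of the logarithm of the Metropolis ratio. -/
def negLogRatio {d : ℕ} (U : E d → ℝ) (γ : ℝ) (x y : E d) : ℝ :=
  U y - U x - inner ℝ (gradient U y) (y - x) +
    inner ℝ (y - x + γ • gradient U x) (gradient U y - gradient U x) / 2 +
    γ / 4 * ‖gradient U y - gradient U x‖ ^ 2

section

variable {d : ℕ} {U : E d → ℝ} {L m K γ η : ℝ}

/-- The terms `‖y - x‖²/(4γ)` of the two Gaussian exponents cancel. The rest is grouped into a
Taylor remainder based at `y`, which is nonpositive under convexity, and terms in the gradient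
increment. -/
lemma accept_eq (hγ : 0 < γ) (x y : E d) :
    accept U γ x y = min 1 (Real.exp (-negLogRatio U γ x y)) := by
  have hc : (4 * Real.pi * γ) ^ (-(d : ℝ) / 2) ≠ 0 := by positivity
  unfold accept target proposal
  generalize (4 * Real.pi * γ) ^ (-(d : ℝ) / 2) = c at hc
  congr 1
  rw [mul_left_comm, mul_left_comm (Real.exp (-U x)), mul_div_mul_left _ _ hc, ← Real.exp_add,
    ← Real.exp_add, ← Real.exp_sub, negLogRatio]
  congr 1
  set h := y - x with hh
  have e1 : x - y = -h := by rw [hh]; abel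
  have s1 : ‖-h + γ • gradient U y‖ ^ 2 =
      ‖h‖ ^ 2 - 2 * γ * inner ℝ (gradient U y) h + γ ^ 2 * ‖gradient U y‖ ^ 2 := by
    rw [norm_add_sq_real, norm_neg, norm_smul, mul_pow, inner_smul_right, Real.norm_eq_abs,
      sq_abs, inner_neg_left, real_inner_comm]
    ring
  have s2 : ‖h + γ • gradient U x‖ ^ 2 =
      ‖h‖ ^ 2 + 2 * γ * inner ℝ (gradient U x) h + γ ^ 2 * ‖gradient U x‖ ^ 2 := by
    rw [norm_add_sq_real, norm_smul, mul_pow, inner_smul_right, Real.norm_eq_abs,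
      sq_abs, real_inner_comm]
    ring
  rw [e1, s1, s2]
  clear_value h
  rw [norm_sub_sq_real, inner_add_left, inner_sub_right, real_inner_smul_left, inner_sub_right,
    real_inner_self_eq_norm_sq, real_inner_comm h (gradient U x),
    real_inner_comm h (gradient U y), real_inner_comm (gradient U y) (gradient U x)]
  field_simp
  ring

lemma accept_nonneg (hγ : 0 < γ) (x y : E d) : 0 ≤ accept U γ x y := by
  rw [accept_eq hγ]; positivity

lemma accept_le_one (x y : E d) : accept U γ x y ≤ 1 := min_le_left _ _

lemma one_sub_accept_le (hγ : 0 < γ) (x y : E d) {c : ℝ} (hc : 0 ≤ c)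
    (h : negLogRatio U γ x y ≤ c) : 1 - accept U γ x y ≤ c := by
  rw [accept_eq hγ, sub_le_comm, le_min_iff]
  exact ⟨by linarith, by linarith [Real.add_one_le_exp (-negLogRatio U γ x y)]⟩

lemma H1.continuous_accept (h : H1 U L) (hγ : 0 < γ) (x : E d) :
    Continuous (accept U γ x) := by
  have hU : Continuous U := h.contDiff.continuous
  have hg := h.continuous_gradient
  simp_rw [funext (accept_eq (U := U) hγ x), negLogRatio]
  fun_prop

/-- A crude bound on the rejection probability, valid everywhere. -/
lemma H1.one_sub_accept_le (h : H1 U L) (hγ : 0 < γ) (hγL : γ * L ≤ 1 / 4) (x y : E d) :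
    1 - accept U γ x y ≤ L * (17 / 8 * (γ * L * ‖x‖) ^ 2) +
      9 / 4 * L * ‖y - x + γ • gradient U x‖ ^ 2 := by
  have hL := h.nonneg
  refine MALA.one_sub_accept_le hγ x y (by positivity) ?_
  set w := y - x + γ • gradient U x with hw
  have hh : ‖y - x‖ ≤ ‖w‖ + γ * L * ‖x‖ := by
    calc ‖y - x‖ = ‖w - γ • gradient U x‖ := by rw [hw]; congr 1; abel
      _ ≤ ‖w‖ + ‖γ • gradient U x‖ := norm_sub_le _ _
      _ ≤ _ := by
        rw [norm_smul, Real.norm_of_nonneg hγ.le, mul_assoc]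
        gcongr; exact h.norm_gradient_le x
  have hh2 : ‖y - x‖ ^ 2 ≤ 2 * ‖w‖ ^ 2 + 2 * (γ * L * ‖x‖) ^ 2 := by
    nlinarith [norm_nonneg (y - x), sq_nonneg (‖w‖ - γ * L * ‖x‖)]
  have hΔ := h.norm_gradient_sub_le x y
  have t1 := h.sub_sub_inner_le x y (c := -(L * ‖y - x‖ ^ 2)) fun t _ _ =>
    neg_le_of_abs_le (h.abs_D2_le _ _)
  have t2 : inner ℝ w (gradient U y - gradient U x) ≤ ‖w‖ * (L * ‖y - x‖) :=
    (real_inner_le_norm _ _).trans (by gcongr)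
  have t3 : γ / 4 * ‖gradient U y - gradient U x‖ ^ 2 ≤ L / 16 * ‖y - x‖ ^ 2 := by
    calc γ / 4 * ‖gradient U y - gradient U x‖ ^ 2 ≤ γ / 4 * (L * ‖y - x‖) ^ 2 := by gcongr
      _ = (γ * L) * (L / 4 * ‖y - x‖ ^ 2) := by ring
      _ ≤ 1 / 4 * (L / 4 * ‖y - x‖ ^ 2) := by gcongr
      _ = _ := by ring
  have t4 : ‖w‖ * (L * ‖y - x‖) / 2 ≤ L * (‖w‖ ^ 2 / 8 + ‖y - x‖ ^ 2 / 2) := by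
    have := mul_nonneg hL (sq_nonneg (‖w‖ / 2 - ‖y - x‖))
    nlinarith
  have t5 := mul_le_mul_of_nonneg_left hh2 hL
  rw [negLogRatio, ← hw]
  linarith

/-- A bound on the rejection probability far from the origin. -/
lemma H3.one_sub_accept_le (h1 : H1 U L) (h3 : H3 U m K) (hγ : 0 < γ) (hγL : γ * L ≤ 1 / 4)
    (hγL2 : γ * L ^ 2 ≤ m / 4) {x : E d} (hx0 : x ≠ 0) (hx : 2 * K ≤ ‖x‖) (y : E d) :
    1 - accept U γ x y ≤
      (L ^ 2 / m + 16 / ‖x‖ ^ 2) * ‖y - x + γ • gradient U x‖ ^ 2 := by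
  have hL := h1.nonneg
  have hm := h3.m_pos
  have hN : 0 < ‖x‖ := norm_pos_iff.2 hx0
  set w := y - x + γ • gradient U x with hw
  -- For large noise the term `16‖w‖²/‖x‖²` alone exceeds `1`, so any rejection probability is
  -- covered.
  rcases le_total (‖x‖ / 4) ‖w‖ with hcase | hcase
  · have : 1 ≤ 16 / ‖x‖ ^ 2 * ‖w‖ ^ 2 := by
      rw [div_mul_eq_mul_div, one_le_div (by positivity)]
      nlinarith
    have h0 : 0 ≤ L ^ 2 / m * ‖w‖ ^ 2 := by positivity
    linarith [accept_nonneg (U := U) hγ x y]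
  have hh : ‖y - x‖ ≤ ‖x‖ / 2 := by
    calc ‖y - x‖ = ‖w - γ • gradient U x‖ := by rw [hw]; congr 1; abel
      _ ≤ ‖w‖ + ‖γ • gradient U x‖ := norm_sub_le _ _
      _ ≤ ‖w‖ + γ * (L * ‖x‖) := by
        rw [norm_smul, Real.norm_of_nonneg hγ.le]
        gcongr; exact h1.norm_gradient_le x
      _ ≤ ‖x‖ / 4 + 1 / 4 * ‖x‖ := by rw [← mul_assoc]; gcongr
      _ = _ := by ring
  refine (MALA.one_sub_accept_le hγ x y (c := L ^ 2 / m * ‖w‖ ^ 2) (by positivity) ?_).trans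
    (by gcongr; linarith [show 0 ≤ 16 / ‖x‖ ^ 2 by positivity])
  have hΔ := h1.norm_gradient_sub_le x y
  -- As `‖y - x‖ ≤ ‖x‖/2`, the whole segment has norm at least `‖x‖/2 ≥ K`. The resulting `-m‖y -
  -- x‖²/2` pays for the two terms `m‖y - x‖²/16` below.
  have t1 := h1.sub_sub_inner_le x y (c := m * ‖y - x‖ ^ 2) fun t ht0 ht1 => by
    refine h3.le_D2 ?_ _
    have a : ‖t • (y - x)‖ ≤ ‖x‖ / 2 := by
      rw [norm_smul, Real.norm_of_nonneg ht0]
      nlinarith [norm_nonneg (y - x)]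
    have b := norm_sub_le (x + t • (y - x)) (t • (y - x))
    rw [add_sub_cancel_right] at b
    linarith
  have t2 : inner ℝ w (gradient U y - gradient U x) ≤ ‖w‖ * (L * ‖y - x‖) :=
    (real_inner_le_norm _ _).trans (by gcongr)
  have t3 : γ / 4 * ‖gradient U y - gradient U x‖ ^ 2 ≤ m / 16 * ‖y - x‖ ^ 2 := by
    calc γ / 4 * ‖gradient U y - gradient U x‖ ^ 2 ≤ γ / 4 * (L * ‖y - x‖) ^ 2 := by gcongr
      _ = (γ * L ^ 2) * (1 / 4 * ‖y - x‖ ^ 2) := by ring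
      _ ≤ m / 4 * (1 / 4 * ‖y - x‖ ^ 2) := by gcongr
      _ = _ := by ring
  have t4 : ‖w‖ * (L * ‖y - x‖) / 2 ≤ L ^ 2 / m * ‖w‖ ^ 2 + m / 16 * ‖y - x‖ ^ 2 := by
    have := mul_nonneg hm.le (sq_nonneg (L * ‖w‖ / m - ‖y - x‖ / 4))
    have e : m * (L * ‖w‖ / m - ‖y - x‖ / 4) ^ 2 =
      L ^ 2 / m * ‖w‖ ^ 2 - ‖w‖ * (L * ‖y - x‖) / 2 + m / 16 * ‖y - x‖ ^ 2 := by
      field_simp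
      ring
    linarith
  rw [negLogRatio, ← hw]
  have : 0 ≤ m * ‖y - x‖ ^ 2 := by positivity
  linarith

/-! ### The kernel -/

lemma continuous_V (η : ℝ) : Continuous (V (d := d) η) := by unfold V; fun_prop

lemma V_nonneg (η : ℝ) (x : E d) : 0 ≤ V η x := (Real.exp_pos _).le

/-- `R_γ V ≤ Q_γ V + (rejection probability) V`, with `Q_γ` the proposal kernel. -/
lemma H1.kernel_V_le (h : H1 U L) (hd : 1 ≤ d) (hγ : 0 < γ) (hη : 4 * γ * η < 1) (x : E d)
    {c₀ c₁ : ℝ} (hc₁ : 0 ≤ c₁)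
    (hacc : ∀ y, 1 - accept U γ x y ≤ c₀ + c₁ * ‖y - x + γ • gradient U x‖ ^ 2) :
    Integrable (V η) (kernel U γ x) ∧ ∫ y, V η y ∂(kernel U γ x) ≤
      (1 - 4 * γ * η) ^ (-(d : ℝ) / 2) *
        Real.exp (η / (1 - 4 * γ * η) * ‖x - γ • gradient U x‖ ^ 2) +
      (c₀ + c₁ * (6 * γ * d)) * V η x := by
  have hα : Continuous (accept U γ x) := h.continuous_accept hγ x
  have hr : Continuous (proposal U γ x) := continuous_proposal x
  have hr0 := fun y => (proposal_pos (U := U) hγ x y).le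
  have hα0 := accept_nonneg (U := U) hγ x
  have hα1 := accept_le_one (U := U) (γ := γ) x
  have hi : Integrable (fun y => proposal U γ x y * V η y) := by
    simpa [V] using integrable_proposal_mul_exp (U := U) hγ hη x 0
  have hI : ∫ y, proposal U γ x y * V η y = (1 - 4 * γ * η) ^ (-(d : ℝ) / 2) *
        Real.exp (η / (1 - 4 * γ * η) * ‖x - γ • gradient U x‖ ^ 2) := by
    simpa [V] using integral_proposal_mul_exp (U := U) hγ hη x 0
  have hp := integrable_proposal (U := U) hγ x
  have hmeas : Measurable fun y => ENNReal.ofReal (accept U γ x y * proposal U γ x y) :=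
    (hα.mul hr).measurable.ennreal_ofReal
  have hrej0 : ∀ y, 0 ≤ (1 - accept U γ x y) * proposal U γ x y := fun y =>
    mul_nonneg (by linarith [hα1 y]) (hr0 y)
  have hrej : Integrable fun y => (1 - accept U γ x y) * proposal U γ x y := by
    refine hp.mono' (by fun_prop) (.of_forall fun y => ?_)
    rw [Real.norm_of_nonneg (hrej0 y)]
    nlinarith [hα0 y, hr0 y]
  have hia : Integrable fun y => V η y * (accept U γ x y * proposal U γ x y) := by
    refine hi.mono' ((continuous_V η).mul (hα.mul hr)).aestronglyMeasurable
      (.of_forall fun y => ?_)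
    have := mul_nonneg (hr0 y) (V_nonneg η y)
    rw [Real.norm_of_nonneg (mul_nonneg (V_nonneg η y) (mul_nonneg (hα0 y) (hr0 y)))]
    nlinarith [hα1 y]
  have htoReal : ∀ y, (ENNReal.ofReal (accept U γ x y * proposal U γ x y)).toReal =
      accept U γ x y * proposal U γ x y := fun y =>
    ENNReal.toReal_ofReal (mul_nonneg (hα0 y) (hr0 y))
  have hlt : ∀ᵐ y : E d, ENNReal.ofReal (accept U γ x y * proposal U γ x y) < ⊤ :=
    .of_forall fun _ => ENNReal.ofReal_lt_top
  have hw1 : Integrable (V η) (volume.withDensity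
      fun y => ENNReal.ofReal (accept U γ x y * proposal U γ x y)) := by
    rw [integrable_withDensity_iff hmeas hlt]
    simpa only [htoReal] using hia
  have hw2 : Integrable (V η)
      ((∫⁻ y : E d, ENNReal.ofReal ((1 - accept U γ x y) * proposal U γ x y)) •
        Measure.dirac x) := by
    refine Integrable.smul_measure (integrable_dirac (by simp)) ?_
    rw [← ofReal_integral_eq_lintegral_ofReal hrej (.of_forall hrej0)]
    exact ENNReal.ofReal_ne_top
  refine ⟨hw1.add_measure hw2, ?_⟩
  rw [kernel, integral_add_measure hw1 hw2, integral_smul_measure, integral_dirac,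
    integral_withDensity_eq_integral_toReal_smul hmeas hlt,
    ← ofReal_integral_eq_lintegral_ofReal hrej (.of_forall hrej0),
    ENNReal.toReal_ofReal (integral_nonneg hrej0), smul_eq_mul, ← hI]
  have hsq := integrable_proposal_mul_sq_norm (U := U) hγ hd x
  -- Accepted moves are compared with all proposals through `α ≤ 1`; the rejected mass multiplies `V
  -- η x`.
  refine add_le_add ?_ (mul_le_mul_of_nonneg_right ?_ (V_nonneg η x))
  · refine integral_mono ?_ hi fun y => ?_
    · simpa only [htoReal, smul_eq_mul, mul_comm] using hia
    · simp only [htoReal, smul_eq_mul]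
      have := mul_nonneg (hr0 y) (V_nonneg η y)
      nlinarith [hα1 y]
  · calc ∫ y, (1 - accept U γ x y) * proposal U γ x y
        ≤ ∫ y, (c₀ * proposal U γ x y +
            c₁ * (proposal U γ x y * ‖y - x + γ • gradient U x‖ ^ 2)) := by
          refine integral_mono hrej ((hp.const_mul _).add (hsq.const_mul _)) fun y => ?_
          have := mul_le_mul_of_nonneg_right (hacc y) (hr0 y)
          simp only
          linarith
      _ = c₀ + c₁ * ∫ y, proposal U γ x y * ‖y - x + γ • gradient U x‖ ^ 2 := by
          rw [integral_add (hp.const_mul _) (hsq.const_mul _), integral_const_mul,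
            integral_const_mul, integral_proposal hγ, mul_one]
      _ ≤ _ := by gcongr; exact integral_proposal_mul_sq_norm_le hγ hd x

end

/-! ### The constants -/

section

variable {d : ℕ} {L m K Υ γ : ℝ}

lemma Ghalf_pos (hd : 1 ≤ d) (hm : 0 < m) (hL : 0 < L) (hΥ : 0 < Υ) : 0 < Ghalf d L m Υ := by
  have hd' : (0 : ℝ) < d := by exact_mod_cast hd
  unfold Ghalf
  positivity

/-- Of `C2` only `2L` and the term `√2 L²/ε` matter. Since `ε⁻¹ ≥ 16√2 L²/m³`, the latter is at
least `32 L⁴/m³`, hence at least `32 L²/m`. -/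
lemma le_bhalf (hd : 1 ≤ d) (hm : 0 < m) (hmL : m ≤ L) (hΥ : 0 < Υ) :
    (2 * L + 32 * (L ^ 2 / m)) * d ≤ bhalf d L m Υ := by
  have hL : 0 < L := hm.trans_le hmL
  have hG := Ghalf_pos hd hm hL hΥ
  have hS : 0 ≤ sSup ((fun u : ℝ => u * Real.exp (-u / 2 ^ 7)) '' Set.Ici 1) := by
    refine Real.sSup_nonneg ?_
    rintro _ ⟨u, hu, rfl⟩
    exact mul_nonneg (zero_le_one.trans hu) (Real.exp_pos _).le
  have heps : 16 * Real.sqrt 2 * L ^ 2 / m ^ 3 ≤ (eps L m (Ghalf d L m Υ))⁻¹ := by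
    have : 0 ≤ (2 : ℝ) ^ (-(3 / 2) : ℝ) * Real.sqrt (Ghalf d L m Υ) * L ^ 3 := by positivity
    rw [eps, mul_inv, inv_inv, inv_div]
    calc 16 * Real.sqrt 2 * L ^ 2 / m ^ 3 = 2 ^ 4 / m ^ 3 * (Real.sqrt 2 * L ^ 2) := by ring
      _ ≤ _ := by gcongr; linarith
  have h0 : 0 ≤ (eps L m (Ghalf d L m Υ))⁻¹ := le_trans (by positivity) heps
  have hmain : 32 * (L ^ 2 / m) ≤ Real.sqrt 2 * L ^ 2 * (eps L m (Ghalf d L m Υ))⁻¹ := by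
    calc 32 * (L ^ 2 / m) ≤ 32 * (L ^ 4 / m ^ 3) := by
          gcongr 32 * ?_
          rw [div_le_div_iff₀ hm (by positivity)]
          have := mul_le_mul_of_nonneg_left (pow_le_pow_left₀ hm.le hmL 2)
            (show 0 ≤ L ^ 2 * m by positivity)
          nlinarith
      _ = Real.sqrt 2 * L ^ 2 * (16 * Real.sqrt 2 * L ^ 2 / m ^ 3) := by
          have := Real.mul_self_sqrt (show (0 : ℝ) ≤ 2 by norm_num)
          linear_combination (-16 * (L ^ 4 / m ^ 3)) * this
      _ ≤ _ := by gcongr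
  have h1 : 0 ≤ Ghalf d L m Υ / 2 * L ^ 2 := by positivity
  have h2 : 0 ≤ (2 : ℝ) ^ (-(3 / 2) : ℝ) * Ghalf d L m Υ ^ (3 / 2 : ℝ) * L ^ 3 *
      (eps L m (Ghalf d L m Υ))⁻¹ := by positivity
  have : 2 * L + 32 * (L ^ 2 / m) ≤ C2 L m (Ghalf d L m Υ) := by
    rw [C2]; linarith
  rw [bhalf]
  nlinarith [mul_le_mul_of_nonneg_right this (Nat.cast_nonneg (α := ℝ) d)]

lemma sixteen_le_KM : 16 ≤ KM d L m K Υ := le_trans (by norm_num) (le_max_left _ _)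

lemma Ktilde_le_KM : Ktilde L m K ≤ KM d L m K Υ :=
  (le_max_left _ _).trans ((le_max_right _ _).trans ((le_max_right _ _).trans (le_max_right _ _)))

lemma bhalf_le (hm : 0 < m) (hb : 0 ≤ bhalf d L m Υ) :
    16 * bhalf d L m Υ ≤ m * eta m * KM d L m K Υ ^ 2 := by
  have h : 4 * Real.sqrt (bhalf d L m Υ) / Real.sqrt (m * eta m) ≤ KM d L m K Υ :=
    (le_max_right _ _).trans ((le_max_right _ _).trans
      ((le_max_right _ _).trans (le_max_right _ _)))
  have hη : 0 < m * eta m := by unfold eta; positivity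
  have h2 := pow_le_pow_left₀ (by positivity) h 2
  rw [div_pow, mul_pow, Real.sq_sqrt hb, Real.sq_sqrt hη.le, div_le_iff₀ hη] at h2
  linarith

lemma G_pos (hd : 1 ≤ d) (hm : 0 < m) (hL : 0 < L) (hΥ : 0 < Υ) : 0 < G d L m K Υ := by
  have hd' : (0 : ℝ) < d := by exact_mod_cast hd
  have := Ghalf_pos hd hm hL hΥ
  have hR : 0 < KM d L m K Υ := lt_of_lt_of_le (by norm_num) sixteen_le_KM
  have hη : 0 < eta m := by unfold eta; positivity
  unfold G
  positivity

lemma step_le (hm : 0 < m) (hmL : m ≤ L) (h : γ ≤ m ^ 3 / (4 * L ^ 4)) :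
    γ * L ≤ 1 / 4 ∧ γ * L ^ 2 ≤ m / 4 := by
  have hL : 0 < L := hm.trans_le hmL
  rw [le_div_iff₀ (by positivity)] at h
  have h3 : m ^ 3 ≤ L ^ 3 := pow_le_pow_left₀ hm.le hmL 3
  have h2 : m ^ 3 ≤ m * L ^ 2 := by nlinarith [pow_le_pow_left₀ hm.le hmL 2]
  constructor
  · refine le_of_mul_le_mul_right ?_ (pow_pos hL 3)
    linarith
  · refine le_of_mul_le_mul_right ?_ (pow_pos hL 2)
    linarith

end

/-! ### The drift inequality -/

section

variable {d : ℕ} {U : E d → ℝ} {L m K γ : ℝ}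

lemma exp_neg_le_one_sub_half {t : ℝ} (h0 : 0 ≤ t) (h1 : t ≤ 1) :
    Real.exp (-t) ≤ 1 - t / 2 := by
  rw [Real.exp_neg, inv_le_iff_one_le_mul₀ (Real.exp_pos t)]
  nlinarith [Real.add_one_le_exp t]

lemma exp_sub_one_le (t : ℝ) : Real.exp t - 1 ≤ t * Real.exp t := by
  have h := Real.add_one_le_exp (-t)
  have := mul_le_mul_of_nonneg_right h (Real.exp_pos t).le
  rw [← Real.exp_add, neg_add_cancel, Real.exp_zero] at this
  linarith

/-- With `k = L/m`, the left side collects the losses near the origin after division by `γP/16`, and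
the right side bounds the gap `exp(η̄R²)/V` from below. -/
lemma mul_exp_le_exp {k : ℝ} (hk : 1 ≤ k) :
    48 * k * Real.exp (12 * k) + 144 * k + 1 ≤ Real.exp (68 * k) := by
  have h1 : k ≤ Real.exp k := by linarith [Real.add_one_le_exp k]
  have h2 : Real.exp k ≤ Real.exp (13 * k) := Real.exp_le_exp.2 (by linarith)
  have h3 : k * Real.exp (12 * k) ≤ Real.exp (13 * k) := by
    calc k * Real.exp (12 * k) ≤ Real.exp k * Real.exp (12 * k) := by gcongr
      _ = Real.exp (13 * k) := by rw [← Real.exp_add]; ring_nf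
  have h4 : 1 ≤ Real.exp (13 * k) := Real.one_le_exp (by linarith)
  have h5 : (193 : ℝ) ≤ Real.exp (55 * k) := by
    calc (193 : ℝ) ≤ 2 ^ 55 := by norm_num
      _ ≤ Real.exp 1 ^ 55 := by gcongr; linarith [Real.add_one_le_exp 1]
      _ = Real.exp 55 := by rw [← Real.exp_nat_mul]; norm_num
      _ ≤ _ := Real.exp_le_exp.2 (by linarith)
  calc _ ≤ 193 * Real.exp (13 * k) := by linarith
    _ ≤ Real.exp (55 * k) * Real.exp (13 * k) := by gcongr
    _ = _ := by rw [← Real.exp_add]; ring_nf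

/-- A bound on `Q_γ V`, with `Q_γ` the proposal kernel, from a contraction estimate on the drift. -/
lemma proposal_V_le (hm : 0 < m) (hγ : 0 < γ) (hγm : γ * m ≤ 1 / 4) {x : E d} {q r : ℝ}
    (hx : ‖x - γ • gradient U x‖ ^ 2 ≤ q * ‖x‖ ^ 2) (hq : q ≤ r * (1 - γ * m / 4)) :
    (1 - 4 * γ * eta m) ^ (-(d : ℝ) / 2) *
      Real.exp (eta m / (1 - 4 * γ * eta m) * ‖x - γ • gradient U x‖ ^ 2) ≤
      Real.exp (d * (γ * m / 4) + eta m * ‖x‖ ^ 2 * r) := by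
  have hη : 0 < eta m := by unfold eta; positivity
  have hs : 4 * γ * eta m = γ * m / 4 := by unfold eta; ring
  rw [hs, Real.exp_add]
  have e1 : (1 - γ * m / 4) ^ (-(d : ℝ) / 2) ≤ Real.exp (d * (γ * m / 4)) :=
    one_sub_rpow_neg_le (by positivity) (by linarith)
  have e2 : eta m / (1 - γ * m / 4) * ‖x - γ • gradient U x‖ ^ 2 ≤ eta m * ‖x‖ ^ 2 * r := by
    rw [div_mul_eq_mul_div, div_le_iff₀ (by linarith), mul_assoc, mul_assoc]
    gcongr
    refine hx.trans ?_
    rw [mul_comm]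
    gcongr
  gcongr

/-- The drift inequality away from the origin. -/
lemma drift_far (hd : 1 ≤ d) (h1 : H1 U L) (h3 : H3 U m K) (hγ : 0 < γ)
    (hγL : γ * L ≤ 1 / 4) (hγL2 : γ * L ^ 2 ≤ m / 4) {R : ℝ} (hR : 16 ≤ R)
    (hKt : Ktilde L m K ≤ R)
    (hP : 16 * ((2 * L + 32 * (L ^ 2 / m)) * d) ≤ m * eta m * R ^ 2)
    (hγP : γ * (m * eta m * R ^ 2) ≤ 4) {x : E d} (hx : 7 / 8 * R ^ 2 ≤ ‖x‖ ^ 2) :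
    Integrable (V (eta m)) (kernel U γ x) ∧ ∫ y, V (eta m) y ∂(kernel U γ x) ≤
      (1 - eta m * m * R ^ 2 / 16 * γ) * V (eta m) x := by
  have hm := h3.m_pos
  have hmL := h3.le_of_H1 hd h1
  have hL : 0 < L := hm.trans_le hmL
  have hd' : (1 : ℝ) ≤ d := by exact_mod_cast hd
  have hη : 0 < eta m := by unfold eta; positivity
  -- This uses `8/7 ≤ (11/10)²`.
  have hRN : R ≤ 11 / 10 * ‖x‖ := by nlinarith [norm_nonneg x]
  have hN : 0 < ‖x‖ := by linarith
  have hx0 : x ≠ 0 := norm_pos_iff.1 hN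
  have hKR : 4 * K ≤ R := by
    have : 1 ≤ L / m := (one_le_div hm).2 hmL
    unfold Ktilde at hKt
    nlinarith [h3.K_nonneg]
  have hKmL : K * (m + L) ≤ m * R / 2 := by
    have : m * Ktilde L m K = 2 * (K * (m + L)) := by unfold Ktilde; field_simp
    nlinarith
  have hγm : γ * m ≤ 1 / 4 := le_trans (by gcongr) hγL
  have hs : 4 * γ * eta m = γ * m / 4 := by unfold eta; ring
  have hLm : L ≤ L ^ 2 / m := by rw [le_div_iff₀ hm]; nlinarith
  set P := m * eta m * R ^ 2 with hPdef
  -- Here `544 = 16 (2 + 32)`, from `L ≤ L²/m`.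
  have hP2 : 544 * L * d ≤ P := by
    have := mul_le_mul_of_nonneg_right hLm (zero_le_one.trans hd')
    linarith
  have hP3 : 544 * m * d ≤ P := le_trans (by gcongr) hP2
  have hmN : 7 / 8 * P ≤ m * (eta m * ‖x‖ ^ 2) := by
    rw [hPdef]
    have := mul_le_mul_of_nonneg_left hx (show 0 ≤ m * eta m by positivity)
    linarith
  have hNd : 400 * 16 * d ≤ m * ‖x‖ ^ 2 := by
    refine le_of_mul_le_mul_left ?_ hm
    unfold eta at hmN
    nlinarith
  have hN16 : 16 / ‖x‖ ^ 2 ≤ L := by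
    rw [div_le_iff₀ (by positivity)]
    nlinarith [sq_nonneg ‖x‖]
  obtain ⟨hint, hle⟩ := h1.kernel_V_le (η := eta m) hd hγ (by rw [hs]; linarith) x (c₀ := 0)
    (c₁ := L ^ 2 / m + 16 / ‖x‖ ^ 2) (by positivity) fun y => by
      rw [zero_add]
      exact h3.one_sub_accept_le h1 hγ hγL hγL2 hx0 (by linarith) y
  refine ⟨hint, hle.trans ?_⟩
  have hinner : 2 / 5 * m * ‖x‖ ^ 2 ≤ inner ℝ (gradient U x) x := by
    refine le_trans ?_ (h3.le_inner_gradient h1 (by linarith))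
    nlinarith [mul_le_mul_of_nonneg_right hKmL hN.le, mul_le_mul_of_nonneg_left hRN hm.le]
  -- The rate is `11/20 = 2·(2/5) - 1/4`: twice the inner product bound less the squared gradient.
  -- Below it splits as `3/10 + 1/4`, the `1/4` offsetting the Gaussian factor `1 - γm/4`.
  have hnorm : ‖x - γ • gradient U x‖ ^ 2 ≤ (1 - 11 / 20 * (γ * m)) * ‖x‖ ^ 2 := by
    have hg : ‖gradient U x‖ ^ 2 ≤ L ^ 2 * ‖x‖ ^ 2 := by
      rw [← mul_pow]
      exact pow_le_pow_left₀ (norm_nonneg _) (h1.norm_gradient_le x) 2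
    have hg2 : γ ^ 2 * ‖gradient U x‖ ^ 2 ≤ γ * (m / 4) * ‖x‖ ^ 2 := by
      calc γ ^ 2 * ‖gradient U x‖ ^ 2 ≤ γ ^ 2 * (L ^ 2 * ‖x‖ ^ 2) := by gcongr
        _ = γ * (γ * L ^ 2) * ‖x‖ ^ 2 := by ring
        _ ≤ _ := by gcongr
    have hi := mul_le_mul_of_nonneg_left hinner hγ.le
    rw [norm_sub_sq_real, inner_smul_right, norm_smul, mul_pow, Real.norm_of_nonneg hγ.le,
      real_inner_comm]
    linarith
  have hQ : (1 - 4 * γ * eta m) ^ (-(d : ℝ) / 2) *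
      Real.exp (eta m / (1 - 4 * γ * eta m) * ‖x - γ • gradient U x‖ ^ 2) ≤
      (1 - γ * P / 8) * V (eta m) x := by
    have e2 := proposal_V_le (r := 1 - 3 / 10 * (γ * m)) hm hγ hγm hnorm
      (by linarith [sq_nonneg (γ * m)])
    have e3 : d * (γ * m / 4) + eta m * ‖x‖ ^ 2 * (1 - 3 / 10 * (γ * m)) ≤
        -(γ * P / 4) + eta m * ‖x‖ ^ 2 := by
      have a := mul_le_mul_of_nonneg_left hmN hγ.le
      have b := mul_le_mul_of_nonneg_left hP3 hγ.le
      have c : 0 ≤ γ * m * d := by positivity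
      linarith
    calc _ ≤ Real.exp (-(γ * P / 4)) * Real.exp (eta m * ‖x‖ ^ 2) := by
          rw [← Real.exp_add]
          exact e2.trans (Real.exp_le_exp.2 e3)
      _ ≤ (1 - γ * P / 4 / 2) * Real.exp (eta m * ‖x‖ ^ 2) := by
        gcongr
        refine exp_neg_le_one_sub_half ?_ (by linarith)
        positivity
      _ = _ := by unfold V; ring
  -- This spends half of the gain `γP/8`; the other half is `ϖγ`.
  have hrej : (0 : ℝ) + (L ^ 2 / m + 16 / ‖x‖ ^ 2) * (6 * γ * d) ≤ γ * P / 16 := by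
    have a : (L ^ 2 / m + 16 / ‖x‖ ^ 2) * (6 * γ * d) ≤ (L ^ 2 / m + L ^ 2 / m) * (6 * γ * d) :=
      mul_le_mul_of_nonneg_right (by linarith) (by positivity)
    have b := mul_le_mul_of_nonneg_left hP hγ.le
    have c : 0 ≤ γ * (L ^ 2 / m * d) := by positivity
    have e : 0 ≤ γ * (L * d) := by positivity
    linarith
  have := mul_le_mul_of_nonneg_right hrej (V_nonneg (eta m) x)
  calc _ ≤ (1 - γ * P / 8) * V (eta m) x + γ * P / 16 * V (eta m) x := by linarith
    _ = _ := by rw [hPdef]; ring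

/-- The drift inequality in a ball around the origin. -/
lemma drift_near (hd : 1 ≤ d) (h1 : H1 U L) (h3 : H3 U m K) (hγ : 0 < γ)
    (hγL : γ * L ≤ 1 / 4) (hγL2 : γ * L ^ 2 ≤ m / 4) {R : ℝ}
    (hP : 16 * ((2 * L + 32 * (L ^ 2 / m)) * d) ≤ m * eta m * R ^ 2)
    (hγP : γ * (m * eta m * R ^ 2) ≤ 4) {x : E d} (hx : ‖x‖ ^ 2 ≤ 7 / 8 * R ^ 2) :
    Integrable (V (eta m)) (kernel U γ x) ∧ ∫ y, V (eta m) y ∂(kernel U γ x) ≤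
      (1 - eta m * m * R ^ 2 / 16 * γ) * V (eta m) x +
        eta m * m * R ^ 2 / 16 * Real.exp (eta m * R ^ 2) * γ := by
  have hm := h3.m_pos
  have hmL := h3.le_of_H1 hd h1
  have hL : 0 < L := hm.trans_le hmL
  have hd' : (1 : ℝ) ≤ d := by exact_mod_cast hd
  have hη : 0 < eta m := by unfold eta; positivity
  have hγm : γ * m ≤ γ * L := by gcongr
  have hs : 4 * γ * eta m = γ * m / 4 := by unfold eta; ring
  have hLm : L ≤ L ^ 2 / m := by rw [le_div_iff₀ hm]; nlinarith
  set k := L / m with hk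
  have hk1 : 1 ≤ k := (one_le_div hm).2 hmL
  have hkm : L = k * m := by rw [hk]; field_simp
  set P := m * eta m * R ^ 2 with hPdef
  set W := eta m * R ^ 2 with hW
  have hPW : P = m * W := by rw [hPdef, hW]; ring
  have hP2 : 544 * L * d ≤ P := by
    have := mul_le_mul_of_nonneg_right hLm (zero_le_one.trans hd')
    linarith
  have hP3 : 544 * L ≤ P := le_trans (by nlinarith) hP2
  have hP0 : 0 < P := by linarith
  have hWk : 544 * k ≤ W := by
    refine le_of_mul_le_mul_left ?_ hm
    rw [← hPW]; rw [hkm] at hP3; linarith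
  set a := eta m * ‖x‖ ^ 2 with ha
  have ha0 : 0 ≤ a := by positivity
  have haW : a ≤ 7 / 8 * W := by
    rw [ha, hW]
    have := mul_le_mul_of_nonneg_left hx hη.le
    linarith
  have hLa : L * a ≤ 7 / 8 * (k * P) := by
    rw [hPW, hkm]
    have := mul_le_mul_of_nonneg_left haW (show 0 ≤ k * m by positivity)
    linarith
  have hPk : P ≤ k * P := by nlinarith
  obtain ⟨hint, hle⟩ := h1.kernel_V_le (η := eta m) hd hγ (by rw [hs]; linarith) x
    (c₀ := L * (17 / 8 * (γ * L * ‖x‖) ^ 2)) (c₁ := 9 / 4 * L) (by positivity)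
    (h1.one_sub_accept_le hγ hγL x)
  refine ⟨hint, hle.trans ?_⟩
  have hnorm : ‖x - γ • gradient U x‖ ^ 2 ≤ ((1 + γ * L) * ‖x‖) ^ 2 := by
    refine pow_le_pow_left₀ (norm_nonneg _) ((norm_sub_le _ _).trans ?_) 2
    rw [norm_smul, Real.norm_of_nonneg hγ.le]
    have := mul_le_mul_of_nonneg_left (h1.norm_gradient_le x) hγ.le
    linarith
  have hQ : (1 - 4 * γ * eta m) ^ (-(d : ℝ) / 2) *
      Real.exp (eta m / (1 - 4 * γ * eta m) * ‖x - γ • gradient U x‖ ^ 2) ≤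
      (1 + γ * (3 * (k * P) * Real.exp (12 * k))) * V (eta m) x := by
    have e2 := proposal_V_le (r := 1 + 3 * (γ * L)) hm hγ (hγm.trans hγL)
      (hnorm.trans_eq (mul_pow _ _ _))
      (by nlinarith [mul_pos hγ hL, mul_pos hγ hm])
    have e3 : d * (γ * m / 4) + a * (1 + 3 * (γ * L)) ≤ γ * (3 * (k * P)) + a := by
      have h := mul_le_mul_of_nonneg_left hLa hγ.le
      have h' := mul_le_mul_of_nonneg_left (hP2.trans hPk) hγ.le
      have h'' : γ * m * d ≤ γ * L * d := by gcongr
      have h0 : 0 ≤ γ * L * d := by positivity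
      linarith
    -- The cap `γP ≤ 4` in `Γ` keeps this exponent bounded, so its exponential is linear in `γ` up
    -- to `exp(12k)`.
    have e4 : γ * (3 * (k * P)) ≤ 12 * k := by
      linarith [mul_le_mul_of_nonneg_left hγP (zero_le_one.trans hk1)]
    have e5 : Real.exp (γ * (3 * (k * P))) ≤ 1 + γ * (3 * (k * P) * Real.exp (12 * k)) := by
      have h := exp_sub_one_le (γ * (3 * (k * P)))
      have h' : γ * (3 * (k * P)) * Real.exp (γ * (3 * (k * P))) ≤
          γ * (3 * (k * P)) * Real.exp (12 * k) := by gcongr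
      linarith
    calc _ ≤ Real.exp (γ * (3 * (k * P))) * Real.exp a := by
          rw [← Real.exp_add]
          exact e2.trans (Real.exp_le_exp.2 e3)
      _ ≤ (1 + γ * (3 * (k * P) * Real.exp (12 * k))) * Real.exp a := by gcongr
      _ = _ := by rw [ha, V]
  have hrej : L * (17 / 8 * (γ * L * ‖x‖) ^ 2) + 9 / 4 * L * (6 * γ * d) ≤ γ * (9 * (k * P)) := by
    have h : L * (17 / 8 * (γ * L * ‖x‖) ^ 2) ≤ γ * (17 / 2 * (L * a)) := by
      calc L * (17 / 8 * (γ * L * ‖x‖) ^ 2)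
          = γ * (17 / 8 * (L * ((γ * L ^ 2) * ‖x‖ ^ 2))) := by ring
        _ ≤ γ * (17 / 8 * (L * ((m / 4) * ‖x‖ ^ 2))) := by gcongr
        _ = _ := by rw [ha]; unfold eta; ring
    have h' := mul_le_mul_of_nonneg_left hLa hγ.le
    have h'' := mul_le_mul_of_nonneg_left (hP2.trans hPk) hγ.le
    have h0 : 0 ≤ γ * (k * P) := by positivity
    linarith
  -- The gap is `W - a ≥ W/8 ≥ 544k/8 = 68k`.
  have hVW : Real.exp (68 * k) * V (eta m) x ≤ Real.exp W := by
    rw [V, ← ha, ← Real.exp_add]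
    exact Real.exp_le_exp.2 (by linarith)
  have hV := V_nonneg (eta m) x
  have hrej' := mul_le_mul_of_nonneg_right hrej hV
  have hexp := (mul_le_mul_of_nonneg_right (mul_exp_le_exp hk1) hV).trans hVW
  have hfin := mul_le_mul_of_nonneg_left hexp (show 0 ≤ γ * P / 16 by positivity)
  have e : eta m * m * R ^ 2 = P := by rw [hPdef]; ring
  rw [e]
  linarith

/-- The drift inequality, with a constant that involves no third derivative. -/
lemma drift_of_H1_H3 {Υ : ℝ} (hd : 1 ≤ d) (hΥ : 0 < Υ) (h1 : H1 U L) (h3 : H3 U m K)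
    (hγ : 0 < γ) (hγG : γ ≤ G d L m K Υ) {b : ℝ}
    (hb : varpi d L m K Υ * Real.exp (eta m * KM d L m K Υ ^ 2) ≤ b) :
    Drift U γ (eta m) (varpi d L m K Υ) b (KM d L m K Υ) := by
  have hm := h3.m_pos
  have hmL := h3.le_of_H1 hd h1
  have hL : 0 < L := hm.trans_le hmL
  have hη : 0 < eta m := by unfold eta; positivity
  have hR : 16 ≤ KM d L m K Υ := sixteen_le_KM
  have hbh := le_bhalf hd hm hmL hΥ
  have hP := (mul_le_mul_of_nonneg_left hbh (by norm_num : (0 : ℝ) ≤ 16)).trans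
    (bhalf_le (K := K) hm (le_trans (by positivity) hbh))
  obtain ⟨hγL, hγL2⟩ := step_le hm hmL
    (hγG.trans ((min_le_right _ _).trans (min_le_left _ _)))
  have hγP : γ * (m * eta m * KM d L m K Υ ^ 2) ≤ 4 := by
    have h : γ ≤ 4 / (m * eta m * KM d L m K Υ ^ 2) :=
      hγG.trans ((min_le_right _ _).trans ((min_le_right _ _).trans (min_le_right _ _)))
    rwa [le_div_iff₀ (by positivity)] at h
  have hϖ : 0 ≤ varpi d L m K Υ := by unfold varpi; positivity
  have hb0 : 0 ≤ b := le_trans (by positivity) hb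
  intro x
  -- Splitting strictly inside the ball leaves the exponential gap needed by the near estimate and
  -- puts the near region inside the open ball.
  rcases le_total (7 / 8 * KM d L m K Υ ^ 2) (‖x‖ ^ 2) with hx | hx
  · obtain ⟨hi, hle⟩ := drift_far hd h1 h3 hγ hγL hγL2 hR Ktilde_le_KM hP hγP hx
    refine ⟨hi, hle.trans (le_add_of_nonneg_right ?_)⟩
    exact mul_nonneg (by positivity) (Set.indicator_nonneg (fun _ _ => zero_le_one) x)
  · obtain ⟨hi, hle⟩ := drift_near hd h1 h3 hγ hγL hγL2 hP hγP hx
    refine ⟨hi, hle.trans ?_⟩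
    have hxR : ‖x‖ < KM d L m K Υ := by
      refine lt_of_pow_lt_pow_left₀ 2 (by linarith) (hx.trans_lt ?_)
      have : 0 < KM d L m K Υ ^ 2 := by positivity
      linarith
    rw [Set.indicator_of_mem (mem_ball_zero_iff.2 hxR), mul_one]
    unfold varpi at hb ⊢
    gcongr

/-- The middle summand of `bM` is exactly the left side; the other two are nonnegative. -/
lemma varpi_mul_exp_le_bM {M Υ γbar : ℝ} (hL : 0 ≤ L) (hM : 0 ≤ M) (hm : 0 < m)
    (hγ : 0 < γbar) :
    varpi d L m K Υ * Real.exp (eta m * KM d L m K Υ ^ 2) ≤ bM d L M m K Υ γbar := by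
  have hη : 0 < eta m := by unfold eta; positivity
  have hrate : 0 ≤ bUrate d L m K γbar := by unfold bUrate; positivity
  have hbU : 0 ≤ bU d L m K γbar := by unfold bU; positivity
  have hC1 : 0 ≤ C1 L M γbar :=
    mul_nonneg zero_le_two (le_max_of_le_left (by positivity))
  have h : 0 ≤ C1 L M γbar * Real.sqrt γbar *
      (d + Real.sqrt 3 * d ^ 2 + KM d L m K Υ ^ 2) := by positivity
  rw [bM, varpi]
  linarith

end

end MALA

end

theorem mainTheorem5 (d : ℕ) (hd : 1 ≤ d) (L m K Υ : ℝ) (hΥ : 0 < Υ) (hΥ_le : Υ ≤ 1) :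
    -- the threshold is positive
    (∀ U : MALA.E d → ℝ, MALA.H1 U L → MALA.H3 U m K →
      0 < MALA.G d L m K Υ ∧ MALA.G d L m K Υ ≤ MALA.Ghalf d L m Υ) ∧
    -- H1 and H3: drift with some constant `b` that does not depend on `U`, on `γ` or on `x`
    (∀ γbar : ℝ, 0 < γbar → γbar ≤ MALA.G d L m K Υ →
      ∃ b : ℝ, ∀ U : MALA.E d → ℝ, MALA.H1 U L → MALA.H3 U m K →
        ∀ γ : ℝ, 0 < γ → γ ≤ γbar →
          MALA.Drift U γ (MALA.eta m) (MALA.varpi d L m K Υ) b (MALA.KM d L m K Υ)) ∧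
    -- if moreover H2 holds, so that `C_{1,γ̄}` is defined: drift with the explicit `b^M`
    (∀ U : MALA.E d → ℝ, MALA.H1 U L → MALA.H3 U m K → ∀ M : ℝ, MALA.H2 U M →
      ∀ γbar : ℝ, 0 < γbar → γbar ≤ MALA.G d L m K Υ →
        ∀ γ : ℝ, 0 < γ → γ ≤ γbar →
          MALA.Drift U γ (MALA.eta m) (MALA.varpi d L m K Υ) (MALA.bM d L M m K Υ γbar)
            (MALA.KM d L m K Υ)) := by
  -- The constant left as `_` is fixed by `le_rfl` to `ϖ exp(η̄ (K^M)²)`, which involves neither `U`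
  -- nor `γ`.
  refine ⟨fun U h1 h3 => ⟨?_, min_le_left _ _⟩, fun γbar _ hG => ⟨_, fun U h1 h3 γ hγ hle =>
    MALA.drift_of_H1_H3 hd hΥ h1 h3 hγ (hle.trans hG) le_rfl⟩,
    fun U h1 h3 M h2 γbar hγbar hG γ hγ hle =>
      MALA.drift_of_H1_H3 hd hΥ h1 h3 hγ (hle.trans hG)
        (MALA.varpi_mul_exp_le_bM h1.nonneg h2.nonneg h3.m_pos hγbar)⟩
  exact MALA.G_pos hd h3.m_pos (h3.m_pos.trans_le (h3.le_of_H1 hd h1)) hΥ
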